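/- Let $\mathbb{k}$ be an algebraically closed field of characteristic $0$, $G$ a finite abelian group and $\Phi\colon G^3\to\mathbb{k}^*$ a normalized $3$-cocycle, i.e. $\Phi(ef,g,h)\Phi(e,f,gh)=\Phi(e,f,g)\Phi(e,fg,h)\Phi(f,g,h)$ and $\Phi(f,1,g)=1$. Put $\widetilde\Phi_g(x,y)=\Phi(g,x,y)\Phi(x,y,g)/\Phi(x,g,y)$. Let ${}^{\mathbb{k}G}_{\mathbb{k}G}\mathcal{YD}^\Phi$ be the braided tensor category of $G$-graded vector spaces $V=\bigoplus_{g\in G}V_g$ with an action $\triangleright$ of $G$ by linear maps preserving each $V_g$ such that $1\triangleright v=v$ and $e\triangleright(f\triangleright v)=\widetilde\Phi_g(e,f)\,(ef)\triangleright v$ for $v\in V_g$; its morphisms are the linear maps that preserve the degree and commute with the action, its unit object is $\mathbb{k}$ in degree $1$ with trivial action, and for $u\in U_e$, $v\in V_f$, $w\in W_g$ the tensor product has $u\otimes v$ in degree $ef$ and $x\triangleright(u\otimes v)=\widetilde\Phi_x(e,f)(x\triangleright u)\otimes(x\triangleright v)$, the associativity constraint is $(u\otimes v)\otimes w\mapsto\Phi(e,f,g)^{-1}u\otimes(v\otimes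 w)$, and the braiding is $u\otimes v\mapsto(e\triangleright v)\otimes u$. A braided linear space in this category is an $\mathbb{N}$-graded Hopf algebra $\mathcal{S}=\bigoplus_{n\ge0}\mathcal{S}(n)$ in the category, generated as a unital algebra by primitive elements $X_1,\dots,X_n$, each homogeneous for the $G$-grading, which form a basis of $V=\mathcal{S}(1)$ and satisfy, with $X^{\overrightarrow{m}}=(\cdots((XX)X)\cdots)X$ ($m$ factors), $X_i^{\overrightarrow{N_i}}=0$ for some positive integers $N_i$, and $X_iX_j=q_{j,i}X_jX_i$ for some $q_{j,i}\in\mathbb{k}$, for all $i\ne j$ (it is not required that these are all the relations). One writes $\mathcal{S}=\mathcal{S}(V)$. Corollary 4.8. Let $\mathcal{S}(V)$ be a finite-dimensional braided linear space, and let $X\in\mathcal{S}(V)$ be a nonzero primitive element (i.e. $\Delta(X)=X\otimes1+1\otimes X$) that is homogeneous of $G$-degree $g\in G$, with $g\triangleright X=qX$ for some $q\in\mathbb{k}$. Then $q\ne1$. Moreover, $q$ is a root of unity, and its multiplicative order $|q|$ is the nilpotency order of $X$: the least positive integer $m$ with $X^{\overrightarrow{m}}=0$ is $|q|$. -/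

import Mathlib

open scoped TensorProduct

/-- A normalized 3-cocycle on the group `G` with values in `kˣ`. -/
structure ThreeCocycle (k G : Type*) [Field k] [CommGroup G] where
  val : G → G → G → kˣ
  cocycle : ∀ e f g h : G,
    val (e * f) g h * val e f (g * h) = val e f g * val e (f * g) h * val f g h
  normalized : ∀ f g : G, val f 1 g = 1

namespace ThreeCocycle

variable {k G : Type*} [Field k] [CommGroup G] (Φ : ThreeCocycle k G)

/-- The 2-cocycle `Φ̃_g(x, y) = Φ(g,x,y) Φ(x,y,g) / Φ(x,g,y)`. -/
def tw (g x y : G) : kˣ := Φ.val g x y * Φ.val x y g / Φ.val x g y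

theorem val_one_left (f g : G) : Φ.val 1 f g = 1 := by
  have h := Φ.cocycle 1 1 f g
  simp only [one_mul, Φ.normalized] at h
  simpa using h

theorem val_one_right (f g : G) : Φ.val f g 1 = 1 := by
  have h := Φ.cocycle f g 1 1
  simp only [mul_one, Φ.normalized] at h
  simpa using h

theorem tw_one (x y : G) : Φ.tw 1 x y = 1 := by
  simp [tw, val_one_left, val_one_right, Φ.normalized]

/-- The compatibility of the twists which makes the tensor product of two Yetter-Drinfeld modules
a Yetter-Drinfeld module. -/
theorem tw_compat (h l x y : G) :
    Φ.tw y h l * Φ.tw x h l * Φ.tw h x y * Φ.tw l x y = Φ.tw (h * l) x y * Φ.tw (x * y) h l := by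
  have e1 := congrArg Additive.ofMul (Φ.cocycle h l x y)
  have e2 := congrArg Additive.ofMul (Φ.cocycle h x l y)
  have e3 := congrArg Additive.ofMul (Φ.cocycle h x y l)
  have e4 := congrArg Additive.ofMul (Φ.cocycle x h l y)
  have e5 := congrArg Additive.ofMul (Φ.cocycle x h y l)
  have e6 := congrArg Additive.ofMul (Φ.cocycle x y h l)
  apply Additive.ofMul.injective
  simp only [tw, ofMul_mul, ofMul_div, mul_comm l x, mul_comm x h, mul_comm y h, mul_comm y l]
    at e1 e2 e3 e4 e5 e6 ⊢
  linear_combination (norm := module) - e1 + e2 - e3 - e4 + e5 - e6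

end ThreeCocycle

/-- A Yetter-Drinfeld module structure over `(kG, Φ)` on the vector space `V`: a `G`-grading
`V = ⨁ V_g`, given by its projections `comp g : V → V_g`, with an action of `G` that turns each
`V_g` into a projective `G`-representation with respect to the 2-cocycle `Φ̃_g`. -/
structure YetterDrinfeld {k G : Type*} [Field k] [CommGroup G] [Fintype G]
    (Φ : ThreeCocycle k G) (V : Type*) [AddCommGroup V] [Module k V] where
  comp : G → V →ₗ[k] V
  act : G → V →ₗ[k] V
  comp_self : ∀ g v, comp g (comp g v) = comp g v
  comp_ne : ∀ g h v, g ≠ h → comp g (comp h v) = 0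
  sum_comp : ∀ v, ∑ g, comp g v = v
  comp_act : ∀ g e v, comp g (act e v) = act e (comp g v)
  act_one : ∀ v, act 1 v = v
  act_act : ∀ e f g v,
    act e (act f (comp g v)) = (Φ.tw g e f : k) • act (e * f) (comp g v)

namespace YetterDrinfeld

variable {k G : Type*} [Field k] [CommGroup G] [Fintype G] {Φ : ThreeCocycle k G}
  {U V W : Type*} [AddCommGroup U] [Module k U] [AddCommGroup V] [Module k V]
  [AddCommGroup W] [Module k W]

/-- `v` is homogeneous of `G`-degree `g`, that is, `v ∈ V_g`. -/
def IsHomogeneous (A : YetterDrinfeld Φ V) (g : G) (v : V) : Prop := A.comp g v = v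

/-- Morphisms: linear maps that preserve the degree and commute with the action. -/
def IsHom (A : YetterDrinfeld Φ V) (B : YetterDrinfeld Φ W) (f : V →ₗ[k] W) : Prop :=
  (∀ g v, f (A.comp g v) = B.comp g (f v)) ∧ ∀ e v, f (A.act e v) = B.act e (f v)

open Classical in
/-- The unit object: `k` in degree `1` with the trivial action. -/
noncomputable def unit (Φ : ThreeCocycle k G) : YetterDrinfeld Φ k where
  comp g := if g = 1 then LinearMap.id else 0
  act _ := LinearMap.id
  comp_self g v := by split_ifs <;> simp
  comp_ne g h v hgh := by
    by_cases h1 : g = 1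
    · have : h ≠ 1 := fun h2 => hgh (h1.trans h2.symm)
      simp [this]
    · simp [h1]
  sum_comp v := by
    rw [Finset.sum_eq_single 1] <;> simp +contextual
  comp_act g e v := rfl
  act_one v := rfl
  act_act e f g v := by
    by_cases h1 : g = 1
    · simp [h1, Φ.tw_one]
    · simp [h1]

/-- The degree `g` projection of `V ⊗ W`: the sum over `e f = g` of the projections to
`V_e ⊗ W_f`. -/
noncomputable def tensorComp (A : YetterDrinfeld Φ V) (B : YetterDrinfeld Φ W) (g : G) :
    V ⊗[k] W →ₗ[k] V ⊗[k] W :=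
  ∑ e, TensorProduct.map (A.comp e) (B.comp (e⁻¹ * g))

/-- The action on `V ⊗ W`: `x ▷ (v ⊗ w) = Φ̃_x(e, f) (x ▷ v) ⊗ (x ▷ w)` for `v ∈ V_e`,
`w ∈ W_f`. -/
noncomputable def tensorAct (A : YetterDrinfeld Φ V) (B : YetterDrinfeld Φ W) (x : G) :
    V ⊗[k] W →ₗ[k] V ⊗[k] W :=
  ∑ e, ∑ f, (Φ.tw x e f : k) •
    TensorProduct.map (A.act x ∘ₗ A.comp e) (B.act x ∘ₗ B.comp f)

theorem comp_eq_zero (A : YetterDrinfeld Φ V) {g h : G} {v : V} (hv : A.comp h v = v)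
    (hgh : g ≠ h) : A.comp g v = 0 := by
  rw [← hv]; exact A.comp_ne g h v hgh

theorem ext_tensor (A : YetterDrinfeld Φ V) (B : YetterDrinfeld Φ W) {P : Type*} [AddCommGroup P]
    [Module k P] {F F' : V ⊗[k] W →ₗ[k] P}
    (h : ∀ e f v w, A.comp e v = v → B.comp f w = w → F (v ⊗ₜ w) = F' (v ⊗ₜ w)) : F = F' := by
  apply TensorProduct.ext'
  intro v w
  rw [← A.sum_comp v, ← B.sum_comp w]
  simp only [TensorProduct.sum_tmul, TensorProduct.tmul_sum, map_sum]
  exact Finset.sum_congr rfl fun f _ => Finset.sum_congr rfl fun e _ =>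
    h _ _ _ _ (A.comp_self _ _) (B.comp_self _ _)

theorem tensorComp_self (A : YetterDrinfeld Φ V) (B : YetterDrinfeld Φ W) {e f : G} {v : V}
    {w : W} (hv : A.comp e v = v) (hw : B.comp f w = w) :
    tensorComp A B (e * f) (v ⊗ₜ w) = v ⊗ₜ w := by
  rw [tensorComp, LinearMap.sum_apply, Finset.sum_eq_single e]
  · simp [hv, hw]
  · intro b _ hb
    simp [A.comp_eq_zero hv hb]
  · simp

theorem tensorComp_ne (A : YetterDrinfeld Φ V) (B : YetterDrinfeld Φ W) {e f g : G} {v : V}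
    {w : W} (hv : A.comp e v = v) (hw : B.comp f w = w) (hg : g ≠ e * f) :
    tensorComp A B g (v ⊗ₜ w) = 0 := by
  rw [tensorComp, LinearMap.sum_apply]
  refine Finset.sum_eq_zero fun b _ => ?_
  by_cases hb : b = e
  · have : b⁻¹ * g ≠ f := fun h => hg (by rw [← h, hb]; simp)
    simp [B.comp_eq_zero hw this]
  · simp [A.comp_eq_zero hv hb]

theorem tensorAct_tmul (A : YetterDrinfeld Φ V) (B : YetterDrinfeld Φ W) {e f : G} {v : V}
    {w : W} (hv : A.comp e v = v) (hw : B.comp f w = w) (x : G) :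
    tensorAct A B x (v ⊗ₜ w) = (Φ.tw x e f : k) • (A.act x v ⊗ₜ B.act x w) := by
  rw [tensorAct, LinearMap.sum_apply, Finset.sum_eq_single e]
  · rw [LinearMap.sum_apply, Finset.sum_eq_single f]
    · simp [hv, hw]
    · intro b _ hb
      simp [B.comp_eq_zero hw hb]
    · simp
  · intro b _ hb
    simp [A.comp_eq_zero hv hb]
  · simp

theorem comp_act_eq (A : YetterDrinfeld Φ V) {e : G} {v : V} (hv : A.comp e v = v) (x : G) :
    A.comp e (A.act x v) = A.act x v := by
  rw [A.comp_act, hv]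

/-- The tensor product of two Yetter-Drinfeld modules. -/
noncomputable def tensor (A : YetterDrinfeld Φ V) (B : YetterDrinfeld Φ W) :
    YetterDrinfeld Φ (V ⊗[k] W) where
  comp := tensorComp A B
  act := tensorAct A B
  comp_self g v := by
    rw [← LinearMap.comp_apply]
    refine LinearMap.congr_fun (ext_tensor A B fun e f v w hv hw => ?_) v
    by_cases hg : g = e * f
    · subst hg
      simp [tensorComp_self A B hv hw]
    · simp [tensorComp_ne A B hv hw hg]
  comp_ne g h v hgh := by
    rw [← LinearMap.comp_apply]
    refine LinearMap.congr_fun (f := _) (g := 0) (ext_tensor A B fun e f v w hv hw => ?_) v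
    by_cases hg : h = e * f
    · subst hg
      simp [tensorComp_self A B hv hw, tensorComp_ne A B hv hw hgh]
    · simp [tensorComp_ne A B hv hw hg]
  sum_comp v := by
    rw [← LinearMap.sum_apply]
    refine LinearMap.congr_fun (f := _) (g := LinearMap.id)
      (ext_tensor A B fun e f v w hv hw => ?_) v
    rw [LinearMap.sum_apply, Finset.sum_eq_single (e * f)]
    · simp [tensorComp_self A B hv hw]
    · intro b _ hb
      exact tensorComp_ne A B hv hw hb
    · simp
  comp_act g x v := by
    rw [← LinearMap.comp_apply, ← LinearMap.comp_apply]
    refine LinearMap.congr_fun (ext_tensor A B fun e f v w hv hw => ?_) v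
    have hv' := A.comp_act_eq hv x
    have hw' := B.comp_act_eq hw x
    by_cases hg : g = e * f
    · subst hg
      simp [tensorComp_self A B hv hw, tensorAct_tmul A B hv hw, tensorComp_self A B hv' hw']
    · simp [tensorComp_ne A B hv hw hg, tensorAct_tmul A B hv hw, tensorComp_ne A B hv' hw' hg]
  act_one v := by
    refine LinearMap.congr_fun (f := _) (g := LinearMap.id)
      (ext_tensor A B fun e f v w hv hw => ?_) v
    simp [tensorAct_tmul A B hv hw, Φ.tw_one, A.act_one, B.act_one]
  act_act x y g v := by
    rw [← LinearMap.comp_apply, ← LinearMap.comp_apply, ← LinearMap.comp_apply,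
      ← LinearMap.smul_apply]
    refine LinearMap.congr_fun (ext_tensor A B fun e f v w hv hw => ?_) v
    by_cases hg : g = e * f
    · subst hg
      have hv' := A.comp_act_eq hv y
      have hw' := B.comp_act_eq hw y
      have h1 := A.act_act x y e v
      have h2 := B.act_act x y f w
      rw [hv] at h1
      rw [hw] at h2
      have h3 := congrArg (Units.val) (Φ.tw_compat e f x y)
      simp only [Units.val_mul] at h3
      simp only [LinearMap.comp_apply, LinearMap.smul_apply, tensorComp_self A B hv hw,
        tensorAct_tmul A B hv hw, map_smul, tensorAct_tmul A B hv' hw', h1, h2,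
        TensorProduct.smul_tmul_smul, smul_smul]
      rw [← h3]
      congr 1
      ring
    · simp [tensorComp_ne A B hv hw hg]

/-- The associativity constraint `(U ⊗ V) ⊗ W → U ⊗ (V ⊗ W)`,
`(u ⊗ v) ⊗ w ↦ Φ(e,f,g)⁻¹ u ⊗ (v ⊗ w)` for `u ∈ U_e`, `v ∈ V_f`, `w ∈ W_g`. -/
noncomputable def assoc (A : YetterDrinfeld Φ U) (B : YetterDrinfeld Φ V)
    (C : YetterDrinfeld Φ W) : (U ⊗[k] V) ⊗[k] W →ₗ[k] U ⊗[k] (V ⊗[k] W) :=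
  ∑ e, ∑ f, ∑ g, ((Φ.val e f g)⁻¹.val : k) • ((TensorProduct.assoc k U V W).toLinearMap ∘ₗ
    TensorProduct.map (TensorProduct.map (A.comp e) (B.comp f)) (C.comp g))

/-- The inverse of the associativity constraint. -/
noncomputable def assocInv (A : YetterDrinfeld Φ U) (B : YetterDrinfeld Φ V)
    (C : YetterDrinfeld Φ W) : U ⊗[k] (V ⊗[k] W) →ₗ[k] (U ⊗[k] V) ⊗[k] W :=
  ∑ e, ∑ f, ∑ g, ((Φ.val e f g).val : k) • ((TensorProduct.assoc k U V W).symm.toLinearMap ∘ₗ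
    TensorProduct.map (A.comp e) (TensorProduct.map (B.comp f) (C.comp g)))

/-- The braiding `V ⊗ W → W ⊗ V`, `v ⊗ w ↦ (e ▷ w) ⊗ v` for `v ∈ V_e`. -/
noncomputable def braiding (A : YetterDrinfeld Φ V) (B : YetterDrinfeld Φ W) :
    V ⊗[k] W →ₗ[k] W ⊗[k] V :=
  ∑ e, TensorProduct.map (B.act e) (A.comp e) ∘ₗ (TensorProduct.comm k V W).toLinearMap

/-- The multiplication of the braided tensor product of two algebras `(A, m)` and `(B, m')`. -/
noncomputable def braidedMul (A : YetterDrinfeld Φ V) (m : V ⊗[k] V →ₗ[k] V)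
    (B : YetterDrinfeld Φ W) (m' : W ⊗[k] W →ₗ[k] W) :
    (V ⊗[k] W) ⊗[k] (V ⊗[k] W) →ₗ[k] V ⊗[k] W :=
  TensorProduct.map m m' ∘ₗ
    assoc (A.tensor A) B B ∘ₗ
    TensorProduct.map (assocInv A A B) LinearMap.id ∘ₗ
    TensorProduct.map (TensorProduct.map LinearMap.id (braiding B A)) LinearMap.id ∘ₗ
    TensorProduct.map (assoc A B A) LinearMap.id ∘ₗ
    assocInv (A.tensor B) A B

end YetterDrinfeld

/-- A Hopf algebra in the braided tensor category of Yetter-Drinfeld modules over `(kG, Φ)`, with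
underlying vector space `H`. The unit morphism is `k → H`, `c ↦ c • one`. -/
structure BraidedHopfAlgebra {k G : Type*} [Field k] [CommGroup G] [Fintype G]
    (Φ : ThreeCocycle k G) (H : Type*) [AddCommGroup H] [Module k H]
    extends YetterDrinfeld Φ H where
  mul : H ⊗[k] H →ₗ[k] H
  one : H
  comul : H →ₗ[k] H ⊗[k] H
  counit : H →ₗ[k] k
  antipode : H →ₗ[k] H
  -- the structure maps are morphisms of the category
  mul_isHom : (toYetterDrinfeld.tensor toYetterDrinfeld).IsHom toYetterDrinfeld mul
  one_isHom : (YetterDrinfeld.unit Φ).IsHom toYetterDrinfeld (LinearMap.toSpanSingleton k H one)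
  comul_isHom : toYetterDrinfeld.IsHom (toYetterDrinfeld.tensor toYetterDrinfeld) comul
  counit_isHom : toYetterDrinfeld.IsHom (YetterDrinfeld.unit Φ) counit
  antipode_isHom : toYetterDrinfeld.IsHom toYetterDrinfeld antipode
  -- algebra in the category
  mul_assoc : mul ∘ₗ TensorProduct.map mul LinearMap.id =
    mul ∘ₗ TensorProduct.map LinearMap.id mul ∘ₗ
      YetterDrinfeld.assoc toYetterDrinfeld toYetterDrinfeld toYetterDrinfeld
  mul_one : ∀ x, mul (x ⊗ₜ one) = x
  one_mul : ∀ x, mul (one ⊗ₜ x) = x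
  -- coalgebra in the category
  coassoc : YetterDrinfeld.assoc toYetterDrinfeld toYetterDrinfeld toYetterDrinfeld ∘ₗ
      TensorProduct.map comul LinearMap.id ∘ₗ comul =
    TensorProduct.map LinearMap.id comul ∘ₗ comul
  comul_counit : ∀ x, TensorProduct.map LinearMap.id counit (comul x) = x ⊗ₜ (1 : k)
  counit_comul : ∀ x, TensorProduct.map counit LinearMap.id (comul x) = (1 : k) ⊗ₜ x
  -- the comultiplication and the counit are algebra maps
  comul_mul : comul ∘ₗ mul =
    YetterDrinfeld.braidedMul toYetterDrinfeld mul toYetterDrinfeld mul ∘ₗ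
      TensorProduct.map comul comul
  comul_one : comul one = one ⊗ₜ one
  counit_mul : ∀ x y, counit (mul (x ⊗ₜ y)) = counit x * counit y
  counit_one : counit one = 1
  -- antipode
  antipode_left : ∀ x, mul (TensorProduct.map antipode LinearMap.id (comul x)) = counit x • one
  antipode_right : ∀ x, mul (TensorProduct.map LinearMap.id antipode (comul x)) = counit x • one

namespace BraidedHopfAlgebra

variable {k G : Type*} [Field k] [CommGroup G] [Fintype G] {Φ : ThreeCocycle k G}
  {H : Type*} [AddCommGroup H] [Module k H]

/-- Primitive elements: `Δ(x) = x ⊗ 1 + 1 ⊗ x`. -/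
def IsPrimitive (S : BraidedHopfAlgebra Φ H) (x : H) : Prop :=
  S.comul x = x ⊗ₜ S.one + S.one ⊗ₜ x

/-- The left-bracketed power `(⋯((x x) x)⋯) x` with `m` factors (and `1` for `m = 0`). -/
def leftPow (S : BraidedHopfAlgebra Φ H) (x : H) : ℕ → H
  | 0 => S.one
  | m + 1 => S.mul (leftPow S x m ⊗ₜ x)

/-- `gr` is a grading `H = ⨁ gr n` by Yetter-Drinfeld submodules which makes `S` an `ℕ`-graded
braided Hopf algebra. -/
structure IsNatGrading (S : BraidedHopfAlgebra Φ H) (gr : ℕ → Submodule k H) : Prop where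
  isInternal : DirectSum.IsInternal gr
  comp_mem : ∀ n g, ∀ x ∈ gr n, S.comp g x ∈ gr n
  act_mem : ∀ n e, ∀ x ∈ gr n, S.act e x ∈ gr n
  one_mem : S.one ∈ gr 0
  mul_mem : ∀ m n, ∀ x ∈ gr m, ∀ y ∈ gr n, S.mul (x ⊗ₜ y) ∈ gr (m + n)
  comul_mem : ∀ n, ∀ x ∈ gr n, S.comul x ∈ ⨆ (i : ℕ) (j : ℕ) (_ : i + j = n),
    LinearMap.range (TensorProduct.map (gr i).subtype (gr j).subtype)
  counit_eq_zero : ∀ n, n ≠ 0 → ∀ x ∈ gr n, S.counit x = 0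
  antipode_mem : ∀ n, ∀ x ∈ gr n, S.antipode x ∈ gr n

end BraidedHopfAlgebra

/-- A braided linear space `𝒮(V)` over `(kG, Φ)`, with underlying vector space `H`: an `ℕ`-graded
braided Hopf algebra, generated by `G`-homogeneous primitive elements `X 1, …, X n` which form a
basis of `V = 𝒮(1)` and satisfy `(X i)^N_i = 0` and `X i X j = q_{j,i} X j X i` for `i ≠ j`.
It is not required that these relations generate all relations, so the algebras presented by them
are included. -/
structure BraidedLinearSpace {k G : Type*} [Field k] [CommGroup G] [Fintype G]
    (Φ : ThreeCocycle k G) (H : Type*) [AddCommGroup H] [Module k H]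
    extends BraidedHopfAlgebra Φ H where
  gr : ℕ → Submodule k H
  isNatGrading : toBraidedHopfAlgebra.IsNatGrading gr
  rank : ℕ
  X : Fin rank → H
  linearIndependent : LinearIndependent k X
  span_X : Submodule.span k (Set.range X) = gr 1
  isPrimitive : ∀ i, toBraidedHopfAlgebra.IsPrimitive (X i)
  isHomogeneous : ∀ i, ∃ g, toBraidedHopfAlgebra.IsHomogeneous g (X i)
  generates : ∀ A : Submodule k H, one ∈ A → (∀ i, X i ∈ A) →
    (∀ x ∈ A, ∀ y ∈ A, mul (x ⊗ₜ y) ∈ A) → A = ⊤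
  nilpotent : ∀ i, ∃ N : ℕ, 0 < N ∧ toBraidedHopfAlgebra.leftPow (X i) N = 0
  quasiComm : ∀ i j, i ≠ j → ∃ q : k, mul (X i ⊗ₜ X j) = q • mul (X j ⊗ₜ X i)

/-! The powers of `X` live in the degrees `g ^ i`, so only the pullback of `Φ` along `i ↦ g ^ i`
matters, and on `ℕ` an explicit cochain `c = powCochain` trivializes it. Up to the units `c(i, j)`
the powers of `X` therefore behave as in an ordinary braided Hopf algebra: `X^i X^j = c(i, j)
X^(i+j)`, and the q-binomial theorem holds in the form `Δ(X^m) = ∑ (m choose i)_q c(i, j)⁻¹ X^i ⊗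
X^j`, summed over `i + j = m` (`comul_leftPow`).

A primitive element has counit `0`, so it lies in positive `ℕ`-degree and is nilpotent by finite
dimension (`exists_leftPow_eq_zero`). Let `N` be its nilpotency order. The powers `X^i` with `i < N`
are linearly independent, so `Δ(X^N) = 0` forces `(N choose i)_q = 0` for all `0 < i < N`. In
characteristic `0` this happens only if `q` is a primitive `N`-th root of unity
(`qBinom.eq_orderOf`), and `N ≥ 2` since `X ≠ 0`. -/

/-- The Gaussian binomial coefficient `(i + j choose i)_q`, defined by Pascal's rule. -/
def qBinom {k : Type*} [Field k] (q : k) : ℕ → ℕ → k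
  | 0, _ => 1
  | _ + 1, 0 => 1
  | i + 1, j + 1 => q ^ (j + 1) * qBinom q i (j + 1) + qBinom q (i + 1) j

/-! ### Gaussian binomials at roots of unity. -/

namespace qBinom

variable {k : Type*} [Field k] (q : k)

@[simp] theorem zero_left (j : ℕ) : qBinom q 0 j = 1 := by
  cases j <;> simp [qBinom]

@[simp] theorem zero_right (i : ℕ) : qBinom q i 0 = 1 := by
  cases i <;> simp [qBinom]

theorem succ_succ (i j : ℕ) :
    qBinom q (i + 1) (j + 1) = q ^ (j + 1) * qBinom q i (j + 1) + qBinom q (i + 1) j := by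
  rw [qBinom]

theorem one_left (j : ℕ) : qBinom q 1 j = ∑ t ∈ Finset.range (j + 1), q ^ t := by
  induction j with
  | zero => simp
  | succ j ih => rw [succ_succ, ih, Finset.sum_range_succ _ (j + 1)]; simp [add_comm]

theorem mul_prod (i j : ℕ) :
    qBinom q i j * ∏ t ∈ Finset.range i, (1 - q ^ (t + 1)) =
      ∏ t ∈ Finset.range i, (1 - q ^ (j + t + 1)) := by
  induction i generalizing j with
  | zero => simp
  | succ i ih =>
    induction j with
    | zero => simp
    | succ j ihj =>
      have h := ih (j + 1)
      rw [Finset.prod_range_succ' (fun t => 1 - q ^ (j + t + 1))] at ihj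
      simp only [show ∀ t, j + (t + 1) + 1 = j + 1 + t + 1 by intro t; ring] at ihj
      rw [← h] at ihj
      rw [succ_succ, add_mul, ihj, Finset.prod_range_succ, Finset.prod_range_succ, ← h]
      ring

/-- Pascal's rule in the shape produced by multiplying the expansion of `Δ(X^m)` by `X ⊗ 1 + 1 ⊗ X`.
-/
theorem sum_antidiagonal_succ {M : Type*} [AddCommGroup M] [Module k M] (F : ℕ → ℕ → M) (m : ℕ) :
    ∑ p ∈ Finset.HasAntidiagonal.antidiagonal (m + 1), qBinom q p.1 p.2 • F p.1 p.2 =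
      ∑ p ∈ Finset.HasAntidiagonal.antidiagonal m, (qBinom q p.1 p.2 * q ^ p.2) • F (p.1 + 1) p.2 +
      ∑ p ∈ Finset.HasAntidiagonal.antidiagonal m, qBinom q p.1 p.2 • F p.1 (p.2 + 1) := by
  -- `L` and `R` are the two summands of Pascal's rule, extended by `0` to the boundary so that the
  -- end term split off each antidiagonal sum vanishes. The rule `L + R` fails only at `(0, 0)`,
  -- which is not on the antidiagonal of `m + 1`.
  let L : ℕ → ℕ → k := fun i j => Nat.casesOn i 0 fun i => qBinom q i j * q ^ j
  let R : ℕ → ℕ → k := fun i j => Nat.casesOn j 0 fun j => qBinom q i j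
  have hLR : ∀ p ∈ Finset.HasAntidiagonal.antidiagonal (m + 1), qBinom q p.1 p.2 = L p.1 p.2 + R p.1 p.2 := by
    rintro ⟨i, j⟩ hp
    rw [Finset.HasAntidiagonal.mem_antidiagonal] at hp
    rcases i with _ | i <;> rcases j with _ | j
    · simp at hp
    · simp [L, R]
    · simp [L, R]
    · simp [L, R, succ_succ, mul_comm]
  rw [Finset.sum_congr rfl fun p hp => by rw [hLR p hp, add_smul], Finset.sum_add_distrib,
    Finset.Nat.sum_antidiagonal_succ, Finset.Nat.sum_antidiagonal_succ']
  simp [L, R]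

variable {q}

/-- A fragment of the q-Lucas theorem: starting from `1`, each Pascal step in `n` adds `0` or `1`,
so the value stays a positive integer, which is nonzero in characteristic `0`. -/
theorem orderOf_left [CharZero k] (hq : 0 < orderOf q) (n : ℕ) :
    ∃ c : ℕ, 0 < c ∧ qBinom q (orderOf q) n = c := by
  obtain ⟨d, hd⟩ : ∃ d, orderOf q = d + 1 := Nat.exists_eq_succ_of_ne_zero hq.ne'
  have hP : ∏ t ∈ Finset.range d, (1 - q ^ (t + 1)) ≠ 0 := by
    refine Finset.prod_ne_zero_iff.mpr fun t ht h => ?_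
    exact pow_ne_one_of_lt_orderOf (n := t + 1) (by omega)
      (by have := Finset.mem_range.mp ht; omega) (sub_eq_zero.mp h).symm
  have hB : ∀ n, qBinom q d n = 0 ∨ q ^ n * qBinom q d n = 1 := by
    intro n
    by_cases hn : orderOf q ∣ n
    · right
      rw [orderOf_dvd_iff_pow_eq_one.mp hn, one_mul]
      apply mul_right_cancel₀ hP
      rw [mul_prod, one_mul]
      refine Finset.prod_congr rfl fun t _ => ?_
      rw [add_assoc, pow_add, orderOf_dvd_iff_pow_eq_one.mp hn, one_mul]
    · left
      refine (mul_eq_zero.mp ?_).resolve_right hP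
      rw [mul_prod]
      have h1 : n % (d + 1) < d + 1 := Nat.mod_lt _ (by omega)
      have h2 : n % (d + 1) ≠ 0 := fun h => hn (hd ▸ Nat.dvd_of_mod_eq_zero h)
      -- For this index the exponent `n + t + 1` is the next multiple of `d + 1` after `n`.
      refine Finset.prod_eq_zero (i := d - n % (d + 1)) (Finset.mem_range.mpr (by omega)) ?_
      rw [sub_eq_zero, eq_comm, ← orderOf_dvd_iff_pow_eq_one, hd]
      refine ⟨n / (d + 1) + 1, ?_⟩
      have := Nat.div_add_mod n (d + 1)
      rw [mul_add]
      omega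
  rw [hd]
  induction n with
  | zero => exact ⟨1, by simp⟩
  | succ n ih =>
    obtain ⟨c, hc, hc'⟩ := ih
    rw [succ_succ, hc']
    rcases hB (n + 1) with h | h
    · exact ⟨c, hc, by rw [h]; simp⟩
    · exact ⟨c + 1, by omega, by rw [h]; push_cast; ring⟩

/-- The case `i = 1` says `1 + q + ⋯ + q^(N-1) = 0`, hence `q ≠ 1` and `q^N = 1`. If the order were
smaller than `N`, taking `i = orderOf q` would contradict `orderOf_left`. -/
theorem eq_orderOf [CharZero k] {N : ℕ} (hN : 2 ≤ N)
    (h : ∀ i j, 0 < i → 0 < j → i + j = N → qBinom q i j = 0) : q ≠ 1 ∧ orderOf q = N := by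
  have h1 := h 1 (N - 1) one_pos (by omega) (by omega)
  rw [one_left, Nat.sub_add_cancel (by omega)] at h1
  have hq1 : q ≠ 1 := by
    rintro rfl
    simp at h1
    omega
  have hqN : q ^ N = 1 := by
    have := geom_sum_mul q N
    rw [h1, zero_mul] at this
    exact (sub_eq_zero.mp this.symm)
  have hpos : 0 < orderOf q := orderOf_pos_iff.mpr (isOfFinOrder_iff_pow_eq_one.mpr ⟨N, by omega, hqN⟩)
  refine ⟨hq1, le_antisymm (orderOf_le_of_pow_eq_one (by omega) hqN) ?_⟩
  by_contra! hlt
  obtain ⟨c, hc, hc'⟩ := orderOf_left hpos (N - orderOf q)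
  rw [h _ _ hpos (by omega) (by omega)] at hc'
  exact hc.ne (by exact_mod_cast hc')

end qBinom

/-! ### Trivializing the cocycle along the powers of `g`. -/

namespace ThreeCocycle

variable {k G : Type*} [Field k] [CommGroup G] (Φ : ThreeCocycle k G) (g : G)

/-- The 2-cochain on `ℕ` that trivializes the inverse of the pullback of `Φ` along `i ↦ g ^ i`. -/
def powCochain (i j : ℕ) : kˣ := ∏ t ∈ Finset.range j, Φ.val (g ^ i) (g ^ t) g

@[simp] theorem powCochain_zero_right (i : ℕ) : Φ.powCochain g i 0 = 1 := by
  simp [powCochain]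

theorem powCochain_succ_right (i j : ℕ) :
    Φ.powCochain g i (j + 1) = Φ.powCochain g i j * Φ.val (g ^ i) (g ^ j) g :=
  Finset.prod_range_succ _ _

/-- The coboundary relation at `(i, 1, j)`. The definition gives it only at `(i, j, 1)`; the cocycle
identity at `(g^i, g, g^j, g)` carries it over by induction on `j`. -/
theorem powCochain_succ_left (i j : ℕ) :
    Φ.powCochain g i (j + 1) * Φ.powCochain g 1 j =
      Φ.val (g ^ i) g (g ^ j) * Φ.powCochain g (i + 1) j := by
  induction j with
  | zero => simp [powCochain_succ_right, Φ.normalized, val_one_right]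
  | succ j ih =>
    have h := Φ.cocycle (g ^ i) g (g ^ j) g
    rw [← pow_succ, ← pow_succ, ← pow_succ'] at h
    rw [powCochain_succ_right _ _ _ (j + 1), powCochain_succ_right _ _ 1,
      powCochain_succ_right _ _ (i + 1), pow_one]
    calc _ = (Φ.powCochain g i (j + 1) * Φ.powCochain g 1 j) *
          (Φ.val (g ^ i) (g ^ (j + 1)) g * Φ.val g (g ^ j) g) := by
          simp only [mul_comm, mul_left_comm, mul_assoc]
      _ = Φ.powCochain g (i + 1) j * (Φ.val (g ^ i) g (g ^ j) *
          Φ.val (g ^ i) (g ^ (j + 1)) g * Φ.val g (g ^ j) g) := by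
          rw [ih]; simp only [mul_comm, mul_left_comm, mul_assoc]
      _ = _ := by rw [← h]; simp only [mul_comm, mul_left_comm]

end ThreeCocycle

/-! ### Structure maps on homogeneous tensors. -/

namespace YetterDrinfeld

variable {k G : Type*} [Field k] [CommGroup G] [Fintype G] {Φ : ThreeCocycle k G}
  {U V W : Type*} [AddCommGroup U] [Module k U] [AddCommGroup V] [Module k V]
  [AddCommGroup W] [Module k W]

theorem assoc_tmul (A : YetterDrinfeld Φ U) (B : YetterDrinfeld Φ V) (C : YetterDrinfeld Φ W)
    {e f g : G} {u : U} {v : V} {w : W} (hu : A.comp e u = u) (hv : B.comp f v = v)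
    (hw : C.comp g w = w) :
    assoc A B C ((u ⊗ₜ v) ⊗ₜ w) = ((Φ.val e f g)⁻¹.val : k) • (u ⊗ₜ (v ⊗ₜ w)) := by
  simp only [assoc, LinearMap.sum_apply]
  rw [Finset.sum_eq_single e, Finset.sum_eq_single f, Finset.sum_eq_single g]
  · simp [hu, hv, hw]
  · intro b _ hb
    simp [C.comp_eq_zero hw hb]
  · simp
  · intro b _ hb
    simp [B.comp_eq_zero hv hb]
  · simp
  · intro b _ hb
    simp [A.comp_eq_zero hu hb]
  · simp

theorem assocInv_tmul (A : YetterDrinfeld Φ U) (B : YetterDrinfeld Φ V) (C : YetterDrinfeld Φ W)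
    {e f g : G} {u : U} {v : V} {w : W} (hu : A.comp e u = u) (hv : B.comp f v = v)
    (hw : C.comp g w = w) :
    assocInv A B C (u ⊗ₜ (v ⊗ₜ w)) = ((Φ.val e f g).val : k) • ((u ⊗ₜ v) ⊗ₜ w) := by
  simp only [assocInv, LinearMap.sum_apply]
  rw [Finset.sum_eq_single e, Finset.sum_eq_single f, Finset.sum_eq_single g]
  · simp [hu, hv, hw]
  · intro b _ hb
    simp [C.comp_eq_zero hw hb]
  · simp
  · intro b _ hb
    simp [B.comp_eq_zero hv hb]
  · simp
  · intro b _ hb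
    simp [A.comp_eq_zero hu hb]
  · simp

theorem braiding_tmul (A : YetterDrinfeld Φ V) (B : YetterDrinfeld Φ W) {e : G} {v : V} (w : W)
    (hv : A.comp e v = v) : braiding A B (v ⊗ₜ w) = B.act e w ⊗ₜ v := by
  rw [braiding, LinearMap.sum_apply, Finset.sum_eq_single e]
  · simp [hv]
  · intro b _ hb
    simp [A.comp_eq_zero hv hb]
  · simp

/-- The four values of `Φ` come from the four rebracketings in `braidedMul`; moving `v'` past `w`
makes the degree `f` of `w` act on `v'`. -/
theorem braidedMul_tmul (A : YetterDrinfeld Φ V) (m : V ⊗[k] V →ₗ[k] V) (B : YetterDrinfeld Φ W)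
    (m' : W ⊗[k] W →ₗ[k] W) {e f e' f' : G} {v v' : V} {w w' : W} (hv : A.comp e v = v)
    (hw : B.comp f w = w) (hv' : A.comp e' v' = v') (hw' : B.comp f' w' = w') :
    braidedMul A m B m' ((v ⊗ₜ w) ⊗ₜ (v' ⊗ₜ w')) =
      ((Φ.val (e * f) e' f' * (Φ.val e f e')⁻¹ * Φ.val e e' f * (Φ.val (e * e') f f')⁻¹ : kˣ) : k) •
        (m (v ⊗ₜ A.act f v') ⊗ₜ m' (w ⊗ₜ w')) := by
  have ha := A.comp_act_eq hv' f
  have h1 : (A.tensor B).comp (e * f) (v ⊗ₜ w) = v ⊗ₜ w := tensorComp_self A B hv hw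
  have h2 : (A.tensor A).comp (e * e') (v ⊗ₜ A.act f v') = v ⊗ₜ A.act f v' :=
    tensorComp_self A A hv ha
  simp only [braidedMul, LinearMap.comp_apply, assocInv_tmul _ A B h1 hv' hw', map_smul,
    TensorProduct.map_tmul, assoc_tmul A B A hv hw hv', ← TensorProduct.smul_tmul',
    LinearMap.id_apply, braiding_tmul B A v' hw, assocInv_tmul A A B hv ha hw,
    assoc_tmul _ B B h2 hw hw', smul_smul, Units.val_mul]

end YetterDrinfeld

open Classical in
theorem LinearIndependent.exists_dual {ι k V : Type*} [Field k] [AddCommGroup V] [Module k V]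
    {v : ι → V} (hv : LinearIndependent k v) (i : ι) :
    ∃ f : V →ₗ[k] k, ∀ j, f (v j) = if j = i then 1 else 0 := by
  obtain ⟨f, hf⟩ := LinearMap.exists_extend ((Module.Basis.span hv).coord i)
  refine ⟨f, fun j => ?_⟩
  have h := LinearMap.congr_fun hf (Module.Basis.span hv j)
  rw [LinearMap.comp_apply, Submodule.subtype_apply, Module.Basis.span_apply] at h
  rw [h]
  simp [Finsupp.single_apply]

/-! ### Powers of a homogeneous primitive element. -/

namespace BraidedHopfAlgebra

variable {k G : Type*} [Field k] [CommGroup G] [Fintype G] {Φ : ThreeCocycle k G}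
  {H : Type*} [AddCommGroup H] [Module k H] (S : BraidedHopfAlgebra Φ H)

theorem comp_one_one : S.comp 1 S.one = S.one := by
  have h := S.one_isHom.1 1 1
  simpa [YetterDrinfeld.unit] using h.symm

theorem act_one_eq (e : G) : S.act e S.one = S.one := by
  have h := S.one_isHom.2 e 1
  simpa [YetterDrinfeld.unit] using h.symm

theorem comp_mul_tmul {e f : G} {u v : H} (hu : S.comp e u = u) (hv : S.comp f v = v) :
    S.comp (e * f) (S.mul (u ⊗ₜ v)) = S.mul (u ⊗ₜ v) := by
  rw [← S.mul_isHom.1]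
  exact congrArg S.mul (YetterDrinfeld.tensorComp_self _ _ hu hv)

theorem mul_assoc_tmul {e f g : G} {u v w : H} (hu : S.comp e u = u) (hv : S.comp f v = v)
    (hw : S.comp g w = w) :
    S.mul (S.mul (u ⊗ₜ v) ⊗ₜ w) = ((Φ.val e f g)⁻¹.val : k) • S.mul (u ⊗ₜ S.mul (v ⊗ₜ w)) := by
  have h := LinearMap.congr_fun S.mul_assoc ((u ⊗ₜ v) ⊗ₜ w)
  simpa [YetterDrinfeld.assoc_tmul _ _ _ hu hv hw] using h

theorem comul_mul_tmul (u v : H) :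
    S.comul (S.mul (u ⊗ₜ v)) = YetterDrinfeld.braidedMul S.toYetterDrinfeld S.mul
      S.toYetterDrinfeld S.mul (S.comul u ⊗ₜ S.comul v) :=
  LinearMap.congr_fun S.comul_mul (u ⊗ₜ v)

theorem one_ne_zero : S.one ≠ 0 := fun h => by
  simpa [h] using S.counit_one

variable {S}

theorem IsPrimitive.counit_eq_zero {x : H} (hx : S.IsPrimitive x) : S.counit x = 0 := by
  have h := S.comul_counit x
  rw [hx] at h
  have h' := congrArg (fun t => S.counit (TensorProduct.rid k H t)) h
  simpa [S.counit_one] using h'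

section Powers

variable {X : H} {g : G} {q : k} (hg : S.comp g X = X)
include hg

theorem comp_leftPow (i : ℕ) : S.comp (g ^ i) (S.leftPow X i) = S.leftPow X i := by
  induction i with
  | zero => simpa [leftPow] using S.comp_one_one
  | succ i ih => rw [pow_succ]; exact S.comp_mul_tmul ih hg

/-- Each rebracketing `X^i (X^j X) → (X^i X^j) X` costs `Φ(g^i, g^j, g)`, and `powCochain` is the
product of these costs. -/
theorem mul_leftPow (i j : ℕ) :
    S.mul (S.leftPow X i ⊗ₜ S.leftPow X j) =
      (Φ.powCochain g i j : k) • S.leftPow X (i + j) := by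
  induction j with
  | zero => simp [leftPow, S.mul_one]
  | succ j ih =>
    have h := S.mul_assoc_tmul (comp_leftPow hg i) (comp_leftPow hg j) hg
    rw [ih, ← TensorProduct.smul_tmul', map_smul] at h
    rw [Φ.powCochain_succ_right, mul_comm, Units.val_mul, mul_smul, ← add_assoc, leftPow, leftPow,
      h, smul_smul, Units.mul_inv, one_smul]

theorem act_pow (hq : S.act g X = q • X) (j : ℕ) :
    S.act (g ^ j) X = (q ^ j * ((Φ.powCochain g 1 j)⁻¹ : kˣ)) • X := by
  induction j with
  | zero => simp [S.act_one]
  | succ j ih =>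
    have h := S.act_act g (g ^ j) g X
    -- The other two factors of the twist are both `Φ(g, g, g^j)` and cancel; what remains is the
    -- ratio of consecutive values of `powCochain` at first argument `1`.
    have htw : Φ.tw g g (g ^ j) = Φ.val g (g ^ j) g := by
      simp [ThreeCocycle.tw]
    rw [hg, ih, map_smul, hq, smul_smul, ← pow_succ', htw] at h
    rw [Φ.powCochain_succ_right, pow_one, mul_inv, ← one_smul k (S.act _ X),
      ← Units.inv_mul (Φ.val g (g ^ j) g), mul_smul, ← h, smul_smul, Units.val_mul]
    congr 1
    ring

theorem leftPow_linearIndependent {N : ℕ} (h0 : S.leftPow X N = 0)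
    (hne : ∀ i < N, S.leftPow X i ≠ 0) :
    LinearIndependent k fun i : Fin N => S.leftPow X i := by
  rw [Fintype.linearIndependent_iff]
  intro c hc i
  have hzero : ∀ m, N ≤ m → S.leftPow X m = 0 := by
    intro m hm
    induction m, hm using Nat.le_induction with
    | base => exact h0
    | succ m _ ih => rw [leftPow, ih]; simp
  induction i using WellFoundedLT.induction with
  | _ i ih =>
    -- Multiplication by `X^(N-1-i)` kills the powers above `i`, while the coefficients below `i`
    -- vanish by induction. Only a unit multiple of `c i • X^(N-1)` survives.
    have h := congrArg (fun v => S.mul (S.leftPow X (N - 1 - i) ⊗ₜ v)) hc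
    simp only [TensorProduct.tmul_sum, map_sum, TensorProduct.tmul_smul, map_smul,
      mul_leftPow hg, TensorProduct.tmul_zero, map_zero] at h
    rw [Finset.sum_eq_single i] at h
    · rw [show N - 1 - (i : ℕ) + i = N - 1 by omega] at h
      have hlt : N - 1 < N := by have := i.isLt; omega
      simpa [hne (N - 1) hlt] using h
    · intro j _ hj
      rcases lt_or_gt_of_ne hj with hj | hj
      · simp [ih j hj]
      · rw [hzero _ (by have : (i : ℕ) < j := hj; omega)]
        simp
    · simp

/-- Induction through `Δ(X^(m+1)) = Δ(X^m) (X ⊗ 1 + 1 ⊗ X)`. In the product with `X ⊗ 1`, the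
braiding moves `X` past `X^j` and yields the factor `q^j` of Pascal's rule. -/
theorem comul_leftPow (hq : S.act g X = q • X) (hX : S.IsPrimitive X) (m : ℕ) :
    S.comul (S.leftPow X m) = ∑ p ∈ Finset.HasAntidiagonal.antidiagonal m, qBinom q p.1 p.2 •
      (((Φ.powCochain g p.1 p.2)⁻¹ : kˣ) : k) • (S.leftPow X p.1 ⊗ₜ[k] S.leftPow X p.2) := by
  induction m with
  | zero => simp [leftPow, S.comul_one]
  | succ m ih =>
    rw [qBinom.sum_antidiagonal_succ q
      (fun i j => (((Φ.powCochain g i j)⁻¹ : kˣ) : k) • (S.leftPow X i ⊗ₜ[k] S.leftPow X j)),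
      leftPow, comul_mul_tmul, hX, ih, TensorProduct.sum_tmul, map_sum, ← Finset.sum_add_distrib]
    refine Finset.sum_congr rfl fun p _ => ?_
    obtain ⟨i, j⟩ := p
    have hi := comp_leftPow hg i
    have hj := comp_leftPow hg j
    rw [← TensorProduct.smul_tmul', ← TensorProduct.smul_tmul', map_smul, map_smul,
      TensorProduct.tmul_add, map_add,
      YetterDrinfeld.braidedMul_tmul _ _ _ _ hi hj hg S.comp_one_one,
      YetterDrinfeld.braidedMul_tmul _ _ _ _ hi hj S.comp_one_one hg,
      act_pow hg hq, S.act_one_eq, S.mul_one, S.mul_one, TensorProduct.tmul_smul, map_smul,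
      smul_add, smul_add, mul_smul]
    congr 1
    · simp only [← TensorProduct.smul_tmul', smul_smul, Φ.val_one_right]
      -- The units from the associators, from the action of `g^j` and from the induction hypothesis
      -- must combine to `c(i+1, j)⁻¹`; this is the coboundary relation at `(i, 1, j)`.
      have hc := congrArg Units.val (Φ.powCochain_succ_left g i j)
      rw [Φ.powCochain_succ_right] at hc
      simp only [Units.val_mul] at hc
      rw [leftPow]
      congr 1
      simp only [Units.val_mul, Units.val_inv_eq_inv_val, Units.val_one, inv_one]
      field_simp
      linear_combination (-qBinom q i j * q ^ j) * hc
    · simp only [smul_smul, Φ.val_one_right, Φ.normalized, Φ.powCochain_succ_right]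
      rw [leftPow]
      congr 1
      simp [mul_comm]

/-- For a nilpotent homogeneous primitive element, the nilpotency order is the order of the
scalar by which its degree acts on it. -/
theorem isLeast_orderOf_of_leftPow_eq_zero [CharZero k] (hq : S.act g X = q • X)
    (hX : S.IsPrimitive X) (hX0 : X ≠ 0) (hnil : ∃ N, S.leftPow X N = 0) :
    q ≠ 1 ∧ IsLeast {m : ℕ | 0 < m ∧ S.leftPow X m = 0} (orderOf q) := by
  classical
  obtain ⟨N, h0, hne⟩ : ∃ N, S.leftPow X N = 0 ∧ ∀ i < N, S.leftPow X i ≠ 0 :=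
    ⟨Nat.find hnil, Nat.find_spec hnil, fun i hi => Nat.find_min hnil hi⟩
  have hN : 2 ≤ N := by
    by_contra! hlt
    obtain rfl | rfl : N = 0 ∨ N = 1 := by omega
    · exact S.one_ne_zero h0
    · exact hX0 (by simpa [leftPow, S.one_mul] using h0)
  have hli := leftPow_linearIndependent hg h0 hne
  have hB : ∀ i j, 0 < i → 0 < j → i + j = N → qBinom q i j = 0 := by
    intro i j hi hj hij
    have h := comul_leftPow hg hq hX N
    -- A functional `f` that reads off the coefficient of `X^i ⊗ X^j`.
    obtain ⟨f, hf⟩ := (hli.tmul_of_isDomain hli).exists_dual (⟨i, by omega⟩, ⟨j, by omega⟩)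
    rw [h0, map_zero] at h
    have h' := congrArg f h
    rw [map_zero, map_sum, Finset.sum_eq_single (i, j)] at h'
    · have h1 := hf (⟨i, by omega⟩, ⟨j, by omega⟩)
      simp only [if_true] at h1
      simpa [h1] using h'.symm
    · rintro ⟨a, b⟩ hab hne'
      rw [Finset.HasAntidiagonal.mem_antidiagonal] at hab
      -- The end terms `(N, 0)` and `(0, N)` lie outside the independent family, but they vanish
      -- because `X^N = 0`.
      by_cases ha : a = N
      · simp [ha, h0]
      by_cases hb : b = N
      · simp [hb, h0]
      dsimp only at hab
      have h1 := hf (⟨a, by omega⟩, ⟨b, by omega⟩)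
      rw [if_neg (by simpa using hne')] at h1
      simp only at h1
      simp [h1]
    · simp [hij]
  obtain ⟨h1, h2⟩ := qBinom.eq_orderOf hN hB
  rw [h2]
  refine ⟨h1, ⟨by omega, h0⟩, fun m hm => ?_⟩
  by_contra! hlt
  exact hne m hlt hm.2

end Powers

end BraidedHopfAlgebra

/-! ### Nilpotency from the `ℕ`-grading. -/

namespace BraidedLinearSpace

variable {k G : Type*} [Field k] [CommGroup G] [Fintype G] {Φ : ThreeCocycle k G}
  {H : Type*} [AddCommGroup H] [Module k H] (S : BraidedLinearSpace Φ H)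

/-- The part `⨁_{m ≥ n} 𝒮(m)` of degree at least `n`. -/
def filtration (n : ℕ) : Submodule k H := ⨆ (m : ℕ) (_ : n ≤ m), S.gr m

theorem gr_le_filtration {m n : ℕ} (h : n ≤ m) : S.gr m ≤ S.filtration n :=
  le_iSup₂_of_le m h le_rfl

theorem mul_mem_filtration {a b : ℕ} {x y : H} (hx : x ∈ S.filtration a)
    (hy : y ∈ S.filtration b) : S.mul (x ⊗ₜ y) ∈ S.filtration (a + b) := by
  have h1 : ∀ n, b ≤ n → ∀ z ∈ S.gr n, S.mul (x ⊗ₜ z) ∈ S.filtration (a + b) := by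
    intro n hn z hz
    have : S.filtration a ≤ (S.filtration (a + b)).comap
        (S.mul ∘ₗ (TensorProduct.mk k H H).flip z) :=
      iSup₂_le fun m hm w hw =>
        S.gr_le_filtration (add_le_add hm hn) (S.isNatGrading.mul_mem m n w hw z hz)
    exact this hx
  have h2 : S.filtration b ≤ (S.filtration (a + b)).comap (S.mul ∘ₗ TensorProduct.mk k H H x) :=
    iSup₂_le h1
  exact h2 hy

theorem exists_filtration_eq_bot [FiniteDimensional k H] : ∃ n, S.filtration n = ⊥ := by
  obtain ⟨n, hn⟩ := (WellFoundedGT.finite_ne_bot_of_iSupIndep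
    S.isNatGrading.isInternal.submodule_iSupIndep).bddAbove
  refine ⟨n + 1, eq_bot_iff.mpr (iSup₂_le fun m hm => ?_)⟩
  by_contra h
  have : m ≤ n := hn fun h' => h h'.le
  omega

/-- This subspace contains the generators, which have degree `1`, and is closed under
multiplication. -/
theorem span_one_sup_filtration_one : Submodule.span k {S.one} ⊔ S.filtration 1 = ⊤ := by
  apply S.generates
  · exact Submodule.mem_sup_left (Submodule.mem_span_singleton_self _)
  · intro i
    exact Submodule.mem_sup_right (S.gr_le_filtration le_rfl
      (S.span_X ▸ Submodule.subset_span (Set.mem_range_self i)))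
  · intro x hx y hy
    obtain ⟨u, hu, x', hx', rfl⟩ := Submodule.mem_sup.mp hx
    obtain ⟨v, hv, y', hy', rfl⟩ := Submodule.mem_sup.mp hy
    obtain ⟨a, rfl⟩ := Submodule.mem_span_singleton.mp hu
    obtain ⟨b, rfl⟩ := Submodule.mem_span_singleton.mp hv
    have hxy : S.mul (x' ⊗ₜ y') ∈ S.filtration 1 :=
      (iSup₂_le fun m hm => S.gr_le_filtration (by omega) : S.filtration (1 + 1) ≤ _)
        (S.mul_mem_filtration hx' hy')
    have h : S.mul ((a • S.one + x') ⊗ₜ (b • S.one + y')) =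
        (a * b) • S.one + (a • y' + (b • x' + S.mul (x' ⊗ₜ y'))) := by
      simp only [TensorProduct.add_tmul, TensorProduct.tmul_add, map_add,
        ← TensorProduct.smul_tmul', TensorProduct.tmul_smul, map_smul, S.one_mul, S.mul_one]
      module
    rw [h]
    exact Submodule.add_mem_sup (Submodule.smul_mem _ _ (Submodule.mem_span_singleton_self _))
      (add_mem (Submodule.smul_mem _ _ hy') (add_mem (Submodule.smul_mem _ _ hx') hxy))

/-- The counit kills positive degrees and sends `1` to `1`, so it reads off the coefficient of `1`
in the decomposition of `x`. -/
theorem mem_filtration_one {x : H} (hx : S.counit x = 0) : x ∈ S.filtration 1 := by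
  have hker : S.filtration 1 ≤ LinearMap.ker S.counit :=
    iSup₂_le fun m hm y hy => S.isNatGrading.counit_eq_zero m (by omega) y hy
  have hmem : x ∈ Submodule.span k {S.one} ⊔ S.filtration 1 :=
    S.span_one_sup_filtration_one ▸ Submodule.mem_top
  obtain ⟨u, hu, y, hy, rfl⟩ := Submodule.mem_sup.mp hmem
  obtain ⟨a, rfl⟩ := Submodule.mem_span_singleton.mp hu
  have hy0 : S.counit y = 0 := hker hy
  have ha : a = 0 := by simpa [hy0, S.counit_one] using hx
  simpa [ha] using hy

theorem exists_leftPow_eq_zero [FiniteDimensional k H] {x : H} (hx : S.counit x = 0) :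
    ∃ N, S.leftPow x N = 0 := by
  have hmem : ∀ n, S.leftPow x n ∈ S.filtration n := by
    intro n
    induction n with
    | zero => exact S.gr_le_filtration le_rfl S.isNatGrading.one_mem
    | succ n ih => exact S.mul_mem_filtration ih (S.mem_filtration_one hx)
  obtain ⟨n, hn⟩ := S.exists_filtration_eq_bot
  exact ⟨n, by simpa [hn] using hmem n⟩

end BraidedLinearSpace

theorem corollary4p8 {k G H : Type*} [Field k] [IsAlgClosed k] [CharZero k]
    [CommGroup G] [Fintype G] (Φ : ThreeCocycle k G)
    [AddCommGroup H] [Module k H] [FiniteDimensional k H] (S : BraidedLinearSpace Φ H)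
    (X : H) (hX0 : X ≠ 0) (hX : S.IsPrimitive X)
    (g : G) (hg : S.IsHomogeneous g X) (q : k) (hq : S.act g X = q • X) :
    q ≠ 1 ∧ IsLeast {m : ℕ | 0 < m ∧ S.leftPow X m = 0} (orderOf q) :=
  BraidedHopfAlgebra.isLeast_orderOf_of_leftPow_eq_zero hg hq hX hX0
    (S.exists_leftPow_eq_zero hX.counit_eq_zero)
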